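/- All algebras are over $\mathbb{C}$. Let $G$ be a compact quantum group algebra (a cosemisimple Hopf $*$-algebra whose Haar functional $\mathbf{h}$ satisfies $\mathbf{h}(aa^*)>0$ for all $a\neq 0$), let $H$ be a cosemisimple Hopf $*$-algebra, let $\pi:G\to H$ be a surjective Hopf $*$-algebra map, and let $M=\{g\in G : (\mathrm{id}\otimes\pi)\Delta(g)=g\otimes 1\}$ be the corresponding quantum homogeneous space, with $M^+=M\cap\ker\varepsilon$. Let $(\Omega^\bullet,\mathrm{d})$ be a covariant differential $*$-calculus over $M$ of total dimension $2n$ (that is, $\Omega^k=0$ for $k>2n$ and $\Omega^{2n}\neq 0$). So $\Omega^\bullet$ is an $\mathbb{N}_0$-graded differential algebra with $\Omega^0=M$ and $\Omega^k=\mathrm{span}\{m_0\,\mathrm{d}m_1\wedge\cdots\wedge \mathrm{d}m_k\}$; the involution of $M$ extends to a conjugate-linear involution of $\Omega^\bullet$ that commutes with $\mathrm{d}$ and satisfies $(\omega\wedge\nu)^*=(-1)^{kl}\nu^*\wedge\omega^*$ for $\omega\in\Omega^k$, $\nu\in\Omega^l$; the coaction $\Delta|_M:M\to G\otimes M$ extends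 to an algebra map $\Delta_L:\Omega^\bullet\to G\otimes\Omega^\bullet$ with $\Delta_L(m\,\mathrm{d}m')=\Delta_L(m)\,(\mathrm{id}\otimes\mathrm{d})\Delta_L(m')$; and it is assumed that $\Omega^\bullet M^+\subseteq M^+\Omega^\bullet$ and that $V^\bullet:=\Omega^\bullet/M^+\Omega^\bullet$ is finite-dimensional. Let $(\Omega^{(\bullet,\bullet)},\kappa)$ be a covariant Kähler structure for $\Omega^\bullet$. That is: (i) $\Omega^{(\bullet,\bullet)}$ is an $\mathbb{N}_0^2$-algebra grading of $\Omega^\bullet$ by left $G$-subcomodules with $\Omega^k=\bigoplus_{a+b=k}\Omega^{(a,b)}$ and $(\Omega^{(a,b)})^*=\Omega^{(b,a)}$, which is integrable: $\mathrm{d}=\partial+\overline{\partial}$, where on $\Omega^{(a,b)}$ the operators $\partial$ and $\overline{\partial}$ are $\mathrm{d}$ followed by the projections to $\Omega^{(a+1,b)}$ and $\Omega^{(a,b+1)}$; (ii) $\kappa\in\Omega^{(1,1)}$ is real, central, left $G$-coinvariant and $\mathrm{d}$-closed; (iii) for $L(\omega):=\kappa\wedge\omega$, the maps $L^{n-k}:\Omega^k\to\Omega^{2n-k}$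 are isomorphisms for all $0\le k<n$. Let $P^k=\ker(L^{n-k+1}|_{\Omega^k})$ for $k\le n$, and $P^{(a,b)}=P^{a+b}\cap\Omega^{(a,b)}$. For $h>0$, put $[m]_h=h^{m-1}+h^{m-3}+\cdots+h^{-m+1}$ and $[m]_h!=[1]_h\cdots[m]_h$, and let $\ast_h$ be the Hodge map, the linear map on $\Omega^\bullet$ determined by $$\ast_h(L^j(\omega))=(-1)^{\frac{k(k+1)}{2}}\,i^{a-b}\,\frac{[j]_h!}{[n-j-k]_h!}\,L^{n-j-k}(\omega)$$ for $\omega\in P^{(a,b)}$, $k=a+b$, $j+k\le n$. Let $\mathrm{vol}:=\ast_h|_{\Omega^{2n}}:\Omega^{2n}\to M$, extended by zero to the forms of lower degree, $g(\omega,\nu):=\mathrm{vol}(\omega\wedge\ast_h(\nu^*))$ and $\int\omega:=\mathbf{h}(\mathrm{vol}(\omega))$. Assume that for some $h>0$ the structure is positive definite, i.e. $([\omega],[\nu])\mapsto\varepsilon(g(\omega,\nu))$ is an inner product on $V^\bullet$, and that the integral is closed, i.e. $\int\mathrm{d}\omega=0$ for all $\omega\in\Omega^{2n-1}$. Then the de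 Rham cohomology groups $H^k=\ker(\mathrm{d}:\Omega^k\to\Omega^{k+1})/\mathrm{d}(\Omega^{k-1})$ satisfy $$\dim H^{2k}\;\ge\;\dim H^0\;\ge\;1\qquad\text{for all }k=0,\dots,n,$$ where dimensions are cardinals and may be infinite. -/

import Mathlib

open scoped TensorProduct ComplexOrder

noncomputable section

namespace NCKahler

/-! ### Hopf star-algebras, Haar functionals, quantum homogeneous spaces -/

section Hopf

/-- A Hopf `*`-algebra over `ℂ`: a Hopf algebra with a conjugate-linear, anti-multiplicative
involution for which the comultiplication is a `*`-map. -/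
class HopfStarAlgebra (G : Type*) [Ring G] [StarRing G] [HopfAlgebra ℂ G] : Prop
    extends StarModule ℂ G where
  comul_star : ∀ g : G, Coalgebra.comul (R := ℂ) (star g) = star (Coalgebra.comul (R := ℂ) g)

/-- A linear functional that is normalised and both left and right invariant. -/
structure IsHaarFunctional {G : Type*} [Ring G] [HopfAlgebra ℂ G] (h : G →ₗ[ℂ] ℂ) : Prop where
  map_one : h 1 = 1
  id_tmul : ∀ g : G,
    TensorProduct.rid ℂ G (h.lTensor G (Coalgebra.comul (R := ℂ) g)) = h g • (1 : G)
  tmul_id : ∀ g : G,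
    TensorProduct.lid ℂ G (h.rTensor G (Coalgebra.comul (R := ℂ) g)) = h g • (1 : G)

/-- Cosemisimplicity, in the form of existence and uniqueness of the Haar functional. -/
class CosemisimpleHopfAlgebra (G : Type*) [Ring G] [HopfAlgebra ℂ G] : Prop where
  existsUnique_haar : ∃! h : G →ₗ[ℂ] ℂ, IsHaarFunctional h

/-- The Haar functional of a cosemisimple Hopf algebra. -/
def haar (G : Type*) [Ring G] [HopfAlgebra ℂ G] [CosemisimpleHopfAlgebra G] : G →ₗ[ℂ] ℂ :=
  (CosemisimpleHopfAlgebra.existsUnique_haar (G := G)).choose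

/-- A compact quantum group algebra: a cosemisimple Hopf `*`-algebra with `h(a a*) > 0` for all
`a ≠ 0` (in particular `h(a a*)` is real). -/
class CompactQuantumGroupAlgebra (G : Type*) [Ring G] [StarRing G] [HopfAlgebra ℂ G] : Prop
    extends HopfStarAlgebra G, CosemisimpleHopfAlgebra G where
  haar_pos : ∀ a : G, a ≠ 0 → 0 < haar G (a * star a)

/-- The data of a quantum homogeneous space: a surjective Hopf `*`-algebra map `π : G → H`.
(A bialgebra map between Hopf algebras automatically respects the antipodes.) -/
structure QuantumHomogeneousSpace (G H : Type*) [Ring G] [StarRing G] [HopfAlgebra ℂ G]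
    [Ring H] [StarRing H] [HopfAlgebra ℂ H] where
  proj : G →ₐc[ℂ] H
  surjective : Function.Surjective proj
  map_star : ∀ g, proj (star g) = star (proj g)

namespace QuantumHomogeneousSpace

variable {G H : Type*} [Ring G] [StarRing G] [HopfAlgebra ℂ G] [HopfStarAlgebra G]
  [Ring H] [StarRing H] [HopfAlgebra ℂ H] [HopfStarAlgebra H]

/-- The homogeneous right `H`-coaction `(id ⊗ π) ∘ Δ` on `G`. -/
def rightCoaction (Q : QuantumHomogeneousSpace G H) : G →ₐ[ℂ] G ⊗[ℂ] H :=
  (Algebra.TensorProduct.map (AlgHom.id ℂ G) (Q.proj : G →ₐ[ℂ] H)).comp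
    (Bialgebra.comulAlgHom ℂ G)

theorem rightCoaction_star (Q : QuantumHomogeneousSpace G H) (g : G) :
    Q.rightCoaction (star g) = star (Q.rightCoaction g) := by
  have key : ∀ t : G ⊗[ℂ] G,
      Algebra.TensorProduct.map (AlgHom.id ℂ G) (Q.proj : G →ₐ[ℂ] H) (star t) =
        star (Algebra.TensorProduct.map (AlgHom.id ℂ G) (Q.proj : G →ₐ[ℂ] H) t) := by
    intro t
    induction t with
    | zero => simp
    | tmul x y => simp [TensorProduct.star_tmul, Q.map_star]
    | add x y hx hy => rw [star_add, map_add, map_add, star_add, hx, hy]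
  simp only [rightCoaction, AlgHom.comp_apply, Bialgebra.comulAlgHom_apply,
    HopfStarAlgebra.comul_star, key]

/-- The `*`-algebra `M = G^H` of elements coinvariant under the homogeneous coaction. -/
def space (Q : QuantumHomogeneousSpace G H) : StarSubalgebra ℂ G where
  toSubalgebra := AlgHom.equalizer Q.rightCoaction Algebra.TensorProduct.includeLeft
  star_mem' := by
    intro a ha
    have ha' : Q.rightCoaction a = a ⊗ₜ[ℂ] 1 := ha
    change Q.rightCoaction (star a) = star a ⊗ₜ[ℂ] 1
    rw [rightCoaction_star, ha', TensorProduct.star_tmul, star_one]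

/-- The inclusion of `M` in `G`, as a linear map. -/
def incl (Q : QuantumHomogeneousSpace G H) : Q.space →ₗ[ℂ] G := Q.space.subtype.toAlgHom.toLinearMap

theorem mem_space (Q : QuantumHomogeneousSpace G H) (g : G) :
    g ∈ Q.space ↔ Q.rightCoaction g = g ⊗ₜ[ℂ] 1 := Iff.rfl

theorem lTensor_incl_injective (Q : QuantumHomogeneousSpace G H) :
    Function.Injective (Q.incl.lTensor G) :=
  Module.Flat.lTensor_preserves_injective_linearMap _ Subtype.val_injective

/-- `M` is a left coideal: the comultiplication of `G` maps `M` into `G ⊗ M`. -/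
theorem comul_mem_range (Q : QuantumHomogeneousSpace G H) (m : Q.space) :
    Coalgebra.comul (R := ℂ) (m : G) ∈ LinearMap.range (Q.incl.lTensor G) := by
  let φ : G →ₗ[ℂ] G ⊗[ℂ] H :=
    Q.rightCoaction.toLinearMap - (TensorProduct.mk ℂ G H).flip 1
  let f : LinearMap.ker φ →ₗ[ℂ] Q.space :=
    { toFun := fun x => ⟨x, by
        have hx := LinearMap.mem_ker.1 x.2
        rw [LinearMap.sub_apply, sub_eq_zero] at hx
        exact (Q.mem_space x).2 hx⟩
      map_add' := fun _ _ => rfl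
      map_smul' := fun _ _ => rfl }
  have hef : Q.incl ∘ₗ f = (LinearMap.ker φ).subtype := rfl
  have hm := (Q.mem_space m).1 m.2
  have hker : Coalgebra.comul (R := ℂ) (m : G) ∈ LinearMap.ker (φ.lTensor G) := by
    let p : G →ₗ[ℂ] H := (Q.proj : G →ₐ[ℂ] H).toLinearMap
    have h0 : Q.rightCoaction.toLinearMap = p.lTensor G ∘ₗ Coalgebra.comul := rfl
    have h1 : ∀ t : (G ⊗[ℂ] G) ⊗[ℂ] G, (p.lTensor G).lTensor G (TensorProduct.assoc ℂ G G G t) =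
        TensorProduct.assoc ℂ G G H (p.lTensor (G ⊗[ℂ] G) t) := fun t => by
      induction t with
      | zero => simp
      | add x y hx hy => simp only [map_add, hx, hy]
      | tmul x y =>
        induction x with
        | zero => simp
        | add x z hx hz => simp only [TensorProduct.add_tmul, map_add, hx, hz]
        | tmul x z => rfl
    have h2 : ∀ t : G ⊗[ℂ] G, p.lTensor (G ⊗[ℂ] G) ((Coalgebra.comul (R := ℂ)).rTensor G t) =
        (Coalgebra.comul (R := ℂ)).rTensor H (p.lTensor G t) := fun t => by
      rw [← LinearMap.comp_apply, ← LinearMap.comp_apply, LinearMap.lTensor_comp_rTensor,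
        LinearMap.rTensor_comp_lTensor]
    have h3 : ∀ t : G ⊗[ℂ] G, TensorProduct.assoc ℂ G G H (t ⊗ₜ[ℂ] (1 : H)) =
        ((TensorProduct.mk ℂ G H).flip 1).lTensor G t := fun t => by
      induction t with
      | zero => simp
      | add x y hx hy => simp only [TensorProduct.add_tmul, map_add, hx, hy]
      | tmul x y => rfl
    have h4 : p.lTensor G (Coalgebra.comul (R := ℂ) (m : G)) = (m : G) ⊗ₜ[ℂ] (1 : H) := hm
    rw [LinearMap.mem_ker, LinearMap.lTensor_sub, LinearMap.sub_apply, sub_eq_zero, h0,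
      LinearMap.lTensor_comp, LinearMap.comp_apply, ← Coalgebra.coassoc_apply, h1, h2, h4,
      LinearMap.rTensor_tmul, h3]
  have hflat : Function.Exact ((LinearMap.ker φ).subtype.lTensor G) (φ.lTensor G) :=
    Module.Flat.lTensor_exact G (LinearMap.exact_subtype_ker_map φ)
  obtain ⟨t, ht⟩ := (hflat _).1 hker
  refine ⟨f.lTensor G t, ?_⟩
  rw [← LinearMap.comp_apply, ← LinearMap.lTensor_comp, hef, ht]

/-- The left `G`-coaction `Δ_L : M → G ⊗ M`, the corestriction of the comultiplication. -/
def leftCoaction (Q : QuantumHomogeneousSpace G H) : Q.space →ₗ[ℂ] G ⊗[ℂ] Q.space :=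
  (LinearEquiv.ofInjective (Q.incl.lTensor G) Q.lTensor_incl_injective).symm.toLinearMap ∘ₗ
    LinearMap.codRestrict (LinearMap.range (Q.incl.lTensor G))
      (Coalgebra.comul (R := ℂ) (A := G) ∘ₗ Q.incl) Q.comul_mem_range

theorem lTensor_incl_leftCoaction (Q : QuantumHomogeneousSpace G H) (m : Q.space) :
    Q.incl.lTensor G (Q.leftCoaction m) = Coalgebra.comul (R := ℂ) (m : G) :=
  congrArg Subtype.val ((LinearEquiv.ofInjective (Q.incl.lTensor G)
    Q.lTensor_incl_injective).apply_symm_apply ⟨_, Q.comul_mem_range m⟩)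

end QuantumHomogeneousSpace

end Hopf

/-! ### Differential calculi -/

/-- A differential calculus over an algebra `A`, with total space `Ω`: an `ℕ`-graded algebra with
a graded derivation `d` of degree `1` and square zero, whose degree-zero part is identified with
`A` by `ι`, and which is generated by `A` in the sense that `Ω^k` is spanned by the forms
`a₀ d a₁ ∧ ⋯ ∧ d a_k`. -/
structure DifferentialCalculus (A Ω : Type*) [Ring A] [Algebra ℂ A] [Ring Ω] [Algebra ℂ Ω] where
  grading : ℕ → Submodule ℂ Ω
  gradedAlgebra : GradedAlgebra grading
  ι : A →ₐ[ℂ] Ω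
  ι_injective : Function.Injective ι
  range_ι : LinearMap.range ι.toLinearMap = grading 0
  d : Ω →ₗ[ℂ] Ω
  d_mem : ∀ k, ∀ ω ∈ grading k, d ω ∈ grading (k + 1)
  d_d : ∀ ω, d (d ω) = 0
  leibniz : ∀ k, ∀ α ∈ grading k, ∀ β, d (α * β) = d α * β + (-1 : ℂ) ^ k • (α * d β)
  grading_eq_span : ∀ k, grading k = Submodule.span ℂ
    {ω | ∃ (a₀ : A) (a : Fin k → A), ω = ι a₀ * (List.ofFn fun i => d (ι (a i))).prod}

attribute [instance] DifferentialCalculus.gradedAlgebra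

namespace DifferentialCalculus

variable {A Ω : Type*} [Ring A] [Algebra ℂ A] [Ring Ω] [Algebra ℂ Ω]

/-- Total dimension `N`: `Ω^k = 0` for `k > N`, and `Ω^N ≠ 0`. -/
def HasTotalDimension (C : DifferentialCalculus A Ω) (N : ℕ) : Prop :=
  (∀ k, N < k → C.grading k = ⊥) ∧ C.grading N ≠ ⊥

/-- The closed `k`-forms, `ker (d : Ω^k → Ω^{k+1})`. -/
def closedForms (C : DifferentialCalculus A Ω) (k : ℕ) : Submodule ℂ Ω :=
  C.grading k ⊓ LinearMap.ker C.d

/-- The exact `k`-forms, the image of `d : Ω^{k-1} → Ω^k`; it is zero for `k = 0`. -/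
def exactForms (C : DifferentialCalculus A Ω) : ℕ → Submodule ℂ Ω
  | 0 => ⊥
  | k + 1 => (C.grading k).map C.d

/-- The de Rham cohomology group `H^k` of the calculus. -/
abbrev Cohomology (C : DifferentialCalculus A Ω) (k : ℕ) : Type _ :=
  C.closedForms k ⧸ (C.exactForms k).submoduleOf (C.closedForms k)

/-- The projection `Ω → Ω^0` followed by the identification of `Ω^0` with `A`. -/
def zeroPart (C : DifferentialCalculus A Ω) : Ω →ₗ[ℂ] A :=
  (LinearEquiv.ofInjective C.ι.toLinearMap C.ι_injective).symm.toLinearMap ∘ₗ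
    LinearMap.codRestrict (LinearMap.range C.ι.toLinearMap) (GradedAlgebra.proj C.grading 0)
      (fun ω => by rw [C.range_ι]; exact SetLike.coe_mem _)

end DifferentialCalculus

/-- A differential `*`-calculus over a `*`-algebra `A`: the involution of `A` extends to a
conjugate-linear involution of `Ω` that commutes with `d` and is graded anti-multiplicative. -/
structure StarCalculus (A Ω : Type*) [Ring A] [StarRing A] [Algebra ℂ A] [Ring Ω] [Algebra ℂ Ω]
    extends DifferentialCalculus A Ω where
  st : Ω →ₗ⋆[ℂ] Ω
  st_st : ∀ ω, st (st ω) = ω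
  st_ι : ∀ a, st (ι a) = ι (star a)
  st_d : ∀ ω, st (d ω) = d (st ω)
  st_mul : ∀ k l, ∀ ω ∈ grading k, ∀ ν ∈ grading l,
    st (ω * ν) = (-1 : ℂ) ^ (k * l) • (st ν * st ω)

/-! ### Complex, symplectic, Hermitian and Kähler structures -/

section Structures

variable {A Ω : Type*} [Ring A] [StarRing A] [Algebra ℂ A] [Ring Ω] [Algebra ℂ Ω]

/-- An almost complex structure: an `ℕ²`-algebra grading that refines the grading by degree and
satisfies `(Ω^{(a,b)})* = Ω^{(b,a)}`. -/
structure AlmostComplexStructure (C : StarCalculus A Ω) where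
  bigrading : ℕ × ℕ → Submodule ℂ Ω
  bigradedAlgebra : GradedAlgebra bigrading
  grading_eq : ∀ k, C.grading k = ⨆ p : {p : ℕ × ℕ // p.1 + p.2 = k}, bigrading p
  st_mem_iff : ∀ a b ω, C.st ω ∈ bigrading (b, a) ↔ ω ∈ bigrading (a, b)

attribute [instance] AlmostComplexStructure.bigradedAlgebra

namespace AlmostComplexStructure

variable {C : StarCalculus A Ω}

/-- The homogeneous operator of bidegree `s` that on `Ω^{(a,b)}` is `d` followed by the projection
onto `Ω^{(a,b)+s}`. -/
def component (J : AlmostComplexStructure C) (s : ℕ × ℕ) : Ω →ₗ[ℂ] Ω :=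
  (DirectSum.toModule ℂ (ℕ × ℕ) Ω fun p =>
    GradedAlgebra.proj J.bigrading (p + s) ∘ₗ C.d ∘ₗ (J.bigrading p).subtype) ∘ₗ
      (DirectSum.decomposeLinearEquiv J.bigrading).toLinearMap

/-- The operator `∂`. -/
def del (J : AlmostComplexStructure C) : Ω →ₗ[ℂ] Ω := J.component (1, 0)

/-- The operator `∂̄`. -/
def delBar (J : AlmostComplexStructure C) : Ω →ₗ[ℂ] Ω := J.component (0, 1)

/-- Integrability, `d = ∂ + ∂̄`; an integrable almost complex structure is a complex structure. -/
def IsIntegrable (J : AlmostComplexStructure C) : Prop := C.d = J.del + J.delBar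

end AlmostComplexStructure

/-- The Lefschetz operator `L(ω) = σ ∧ ω` of a form `σ`. -/
def lefschetz (σ : Ω) : Module.End ℂ Ω := LinearMap.mulLeft ℂ σ

/-- An almost symplectic form for a calculus of total dimension `2n`: a central real `2`-form for
which `L^{n-k} : Ω^k → Ω^{2n-k}` is an isomorphism for all `0 ≤ k < n`. -/
structure IsAlmostSymplectic (C : StarCalculus A Ω) (n : ℕ) (σ : Ω) : Prop where
  mem : σ ∈ C.grading 2
  central : ∀ ω, σ * ω = ω * σ
  real : C.st σ = σ
  bijOn : ∀ k, k < n →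
    Set.BijOn (lefschetz σ ^ (n - k)) (C.grading k) (C.grading (2 * n - k))

/-- An Hermitian structure for a `*`-calculus of total dimension `2n`: a complex structure and an
almost symplectic form of bidegree `(1,1)`. -/
structure HermitianStructure (C : StarCalculus A Ω) (n : ℕ) extends AlmostComplexStructure C where
  totalDimension : C.HasTotalDimension (2 * n)
  integrable : toAlmostComplexStructure.IsIntegrable
  form : Ω
  almostSymplectic : IsAlmostSymplectic C n form
  form_mem : form ∈ bigrading (1, 1)

/-- The quantum integer `[m]_h = h^{m-1} + h^{m-3} + ⋯ + h^{-m+1}`. -/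
def quantumInt (h : ℝ) (m : ℕ) : ℝ := ∑ i ∈ Finset.range m, h ^ ((m : ℤ) - 1 - 2 * i)

/-- The quantum factorial `[m]_h! = [1]_h [2]_h ⋯ [m]_h`. -/
def quantumFactorial (h : ℝ) (m : ℕ) : ℝ := ∏ i ∈ Finset.range m, quantumInt h (i + 1)

namespace HermitianStructure

variable {C : StarCalculus A Ω} {n : ℕ}

/-- The Lefschetz operator of the Hermitian form. -/
def L (K : HermitianStructure C n) : Module.End ℂ Ω := lefschetz K.form

/-- The primitive `k`-forms. -/
def primitive (K : HermitianStructure C n) (k : ℕ) : Submodule ℂ Ω :=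
  if k ≤ n then C.grading k ⊓ LinearMap.ker (K.L ^ (n - k + 1)) else ⊥

/-- The primitive `(a,b)`-forms. -/
def bigradedPrimitive (K : HermitianStructure C n) (a b : ℕ) : Submodule ℂ Ω :=
  K.primitive (a + b) ⊓ K.bigrading (a, b)

/-- The defining property of the `h`-Hodge map: for `ω ∈ P^{(a,b)}` and `k = a + b`,
`*_h (L^j ω) = (-1)^{k(k+1)/2} i^{a-b} ([j]_h! / [n-j-k]_h!) L^{n-j-k} ω`.
It is required for `j + k ≤ n`; for all other `j` the form `L^j ω` is zero. -/
def IsHodgeMap (K : HermitianStructure C n) (h : ℝ) (T : Module.End ℂ Ω) : Prop :=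
  ∀ a b j : ℕ, j + (a + b) ≤ n → ∀ ω ∈ K.bigradedPrimitive a b,
    T ((K.L ^ j) ω) =
      ((-1 : ℂ) ^ ((a + b) * (a + b + 1) / 2) * Complex.I ^ ((a : ℤ) - b) *
        ((quantumFactorial h j / quantumFactorial h (n - j - (a + b)) : ℝ) : ℂ)) •
          (K.L ^ (n - j - (a + b))) ω

theorem L_pow_apply (K : HermitianStructure C n) (r : ℕ) (ω : Ω) :
    (K.L ^ r) ω = K.form ^ r * ω := by
  rw [L, lefschetz, LinearMap.pow_mulLeft, LinearMap.mulLeft_apply]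

theorem L_pow_L_pow (K : HermitianStructure C n) (r s : ℕ) (ω : Ω) :
    (K.L ^ r) ((K.L ^ s) ω) = (K.L ^ (r + s)) ω := by
  rw [pow_add, Module.End.mul_apply]

theorem form_pow_mem_bigrading (K : HermitianStructure C n) (r : ℕ) :
    K.form ^ r ∈ K.bigrading (r, r) := by
  have := SetLike.pow_mem_graded r K.form_mem
  simpa using this

theorem L_pow_mem (K : HermitianStructure C n) (r k : ℕ) {ω : Ω} (hω : ω ∈ C.grading k) :
    (K.L ^ r) ω ∈ C.grading (2 * r + k) := by
  rw [L_pow_apply]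
  have := SetLike.mul_mem_graded (SetLike.pow_mem_graded r K.almostSymplectic.mem) hω
  simpa [mul_comm] using this

theorem L_pow_bijOn (K : HermitianStructure C n) {k : ℕ} (hk : k ≤ n) :
    Set.BijOn (K.L ^ (n - k)) (C.grading k) (C.grading (2 * n - k)) := by
  rcases hk.lt_or_eq with hk | rfl
  · exact K.almostSymplectic.bijOn k hk
  · have : 2 * k - k = k := by omega
    rw [this, Nat.sub_self, pow_zero]
    exact Set.bijOn_id _

theorem mem_primitive (K : HermitianStructure C n) {k : ℕ} (hk : k ≤ n) (ω : Ω) :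
    ω ∈ K.primitive k ↔ ω ∈ C.grading k ∧ (K.L ^ (n - k + 1)) ω = 0 := by
  rw [primitive, if_pos hk, Submodule.mem_inf, LinearMap.mem_ker]

theorem L_pow_primitive_eq_zero (K : HermitianStructure C n) {k r : ℕ} (hk : k ≤ n)
    (hr : n - k < r) {ω : Ω} (hω : ω ∈ K.primitive k) : (K.L ^ r) ω = 0 := by
  have h1 := ((K.mem_primitive hk ω).1 hω).2
  obtain ⟨s, rfl⟩ := Nat.exists_eq_add_of_le' (Nat.succ_le_of_lt hr)
  rw [Nat.succ_eq_add_one, ← L_pow_L_pow, h1, map_zero]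

theorem bigrading_le (K : HermitianStructure C n) (p : ℕ × ℕ) :
    K.bigrading p ≤ C.grading (p.1 + p.2) := by
  rw [K.grading_eq]
  exact le_iSup (fun q : {q : ℕ × ℕ // q.1 + q.2 = p.1 + p.2} => K.bigrading q) ⟨p, rfl⟩

theorem bigraded_component_eq_zero (K : HermitianStructure C n) {k : ℕ} {p : ℕ × ℕ}
    (hp : p.1 + p.2 ≠ k) {ω : Ω} (hω : ω ∈ C.grading k) :
    (DirectSum.decompose K.bigrading ω p : Ω) = 0 := by
  rw [K.grading_eq] at hω
  induction hω using Submodule.iSup_induction' with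
  | mem q x hx =>
    refine DirectSum.decompose_of_mem_ne _ hx ?_
    rintro rfl
    exact hp q.2
  | zero => simp
  | add x y _ _ hx hy => simp [hx, hy]

theorem bigraded_component_mem (K : HermitianStructure C n) {k : ℕ} (hk : k ≤ n) {p : ℕ × ℕ}
    (hp : p.1 + p.2 = k) {ω : Ω} (hω : ω ∈ K.primitive k) :
    (DirectSum.decompose K.bigrading ω p : Ω) ∈ K.bigradedPrimitive p.1 p.2 := by
  refine Submodule.mem_inf.2 ⟨?_, SetLike.coe_mem _⟩
  rw [hp, K.mem_primitive hk]
  refine ⟨hp ▸ K.bigrading_le p (SetLike.coe_mem _), ?_⟩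
  have h1 := ((K.mem_primitive hk ω).1 hω).2
  rw [L_pow_apply] at h1 ⊢
  rw [← DirectSum.coe_decompose_mul_add_of_left_mem K.bigrading
    (K.form_pow_mem_bigrading (n - k + 1)), h1]
  simp

/-- The index set `{(k, j) | k + j ≤ n}` of the Lefschetz decomposition. -/
def lefschetzIndex (n : ℕ) : Finset (ℕ × ℕ) :=
  (Finset.range (n + 1) ×ˢ Finset.range (n + 1)).filter fun p => p.1 + p.2 ≤ n

theorem mem_lefschetzIndex (p : ℕ × ℕ) : p ∈ lefschetzIndex n ↔ p.1 + p.2 ≤ n := by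
  simp only [lefschetzIndex, Finset.mem_filter, Finset.mem_product, Finset.mem_range]
  omega

/-- The map `(α_{k,j}) ↦ ∑ L^j α_{k,j}` from families of primitive forms to forms. -/
def lefschetzSum (K : HermitianStructure C n) :
    ((i : lefschetzIndex n) → K.primitive i.1.1) →ₗ[ℂ] Ω :=
  ∑ i : lefschetzIndex n, (K.L ^ i.1.2) ∘ₗ (K.primitive i.1.1).subtype ∘ₗ LinearMap.proj i

theorem lefschetzSum_apply (K : HermitianStructure C n)
    (x : (i : lefschetzIndex n) → K.primitive i.1.1) :
    K.lefschetzSum x = ∑ i, (K.L ^ i.1.2) (x i : Ω) := by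
  simp [lefschetzSum, LinearMap.sum_apply]

theorem lefschetzSum_injective (K : HermitianStructure C n) :
    Function.Injective K.lefschetzSum := by
  rw [← LinearMap.ker_eq_bot, LinearMap.ker_eq_bot']
  classical
  intro x hx
  by_contra hne
  obtain ⟨i₀, hi₀⟩ := Function.ne_iff.1 hne
  obtain ⟨i, hi, hmin⟩ := Finset.exists_min_image
    (Finset.univ.filter fun i => x i ≠ 0) (fun i : lefschetzIndex n => i.1.1)
    ⟨i₀, by simpa using hi₀⟩
  have hin := (mem_lefschetzIndex i.1).1 i.2
  refine (Finset.mem_filter.1 hi).2 ?_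
  have hgr : ∀ i' : lefschetzIndex n, (x i' : Ω) ∈ C.grading i'.1.1 := fun i' =>
    ((K.mem_primitive (by have := (mem_lefschetzIndex i'.1).1 i'.2; omega) _).1 (x i').2).1
  have h0 : GradedAlgebra.proj C.grading (2 * n - i.1.1)
      ((K.L ^ (n - i.1.1 - i.1.2)) (K.lefschetzSum x)) = 0 := by rw [hx, map_zero, map_zero]
  rw [lefschetzSum_apply, map_sum, map_sum, Finset.sum_eq_single i] at h0
  · rw [L_pow_L_pow, show n - i.1.1 - i.1.2 + i.1.2 = n - i.1.1 by omega,
      GradedAlgebra.proj_apply, DirectSum.decompose_of_mem_same] at h0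
    · have hb := K.L_pow_bijOn (k := i.1.1) (by omega)
      exact Subtype.ext (hb.injOn (hgr i) (Submodule.zero_mem _) (h0.trans (map_zero _).symm))
    · have := K.L_pow_mem (n - i.1.1) i.1.1 (hgr i)
      rwa [show 2 * (n - i.1.1) + i.1.1 = 2 * n - i.1.1 by omega] at this
  · intro i' _ hi'
    rw [L_pow_L_pow]
    have hin' := (mem_lefschetzIndex i'.1).1 i'.2
    by_cases hx' : x i' = 0
    · rw [hx']; simp
    have hle := hmin i' (by simpa using hx')
    have hneq : ¬(i'.1.1 = i.1.1 ∧ i'.1.2 = i.1.2) := fun h =>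
      hi' (Subtype.ext (Prod.ext h.1 h.2))
    by_cases hdeg : 2 * (n - i.1.1 - i.1.2 + i'.1.2) + i'.1.1 = 2 * n - i.1.1
    · rw [K.L_pow_primitive_eq_zero (by omega) (by omega) (x i').2, map_zero]
    · rw [GradedAlgebra.proj_apply]
      exact DirectSum.decompose_of_mem_ne _ (K.L_pow_mem _ _ (hgr i')) hdeg
  · intro h; exact absurd (Finset.mem_univ _) h

theorem L_pow_primitive_mem_range (K : HermitianStructure C n) {k j : ℕ} (h : k + j ≤ n) {α : Ω}
    (hα : α ∈ K.primitive k) :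
    K.lefschetzSum (Pi.single ⟨(k, j), (mem_lefschetzIndex _).2 h⟩ ⟨α, hα⟩) = (K.L ^ j) α := by
  rw [lefschetzSum_apply, Finset.sum_eq_single ⟨(k, j), (mem_lefschetzIndex _).2 h⟩]
  · rw [Pi.single_eq_same]
  · intro i _ hi
    rw [Pi.single_eq_of_ne hi]; simp
  · intro h; exact absurd (Finset.mem_univ _) h

theorem L_pow_mem_range (K : HermitianStructure C n) (r : ℕ) {ω : Ω}
    (hω : ω ∈ LinearMap.range K.lefschetzSum) :
    (K.L ^ r) ω ∈ LinearMap.range K.lefschetzSum := by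
  obtain ⟨x, rfl⟩ := hω
  rw [lefschetzSum_apply, map_sum]
  refine Submodule.sum_mem _ fun i _ => ?_
  have hin := (mem_lefschetzIndex i.1).1 i.2
  rw [L_pow_L_pow]
  by_cases h : i.1.1 + (r + i.1.2) ≤ n
  · exact ⟨_, K.L_pow_primitive_mem_range h (x i).2⟩
  · rw [K.L_pow_primitive_eq_zero (by omega) (by omega) (x i).2]
    exact Submodule.zero_mem _

theorem grading_le_range (K : HermitianStructure C n) {k : ℕ} (hk : k ≤ n) :
    C.grading k ≤ LinearMap.range K.lefschetzSum := by
  induction k using Nat.strong_induction_on with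
  | _ k ih =>
    intro ω hω
    have prim : ∀ α ∈ K.primitive k, α ∈ LinearMap.range K.lefschetzSum := fun α hα =>
      ⟨_, by simpa using K.L_pow_primitive_mem_range (j := 0) (by omega) hα⟩
    have hmem := K.L_pow_mem (n - k + 1) k hω
    rcases Nat.lt_or_ge k 2 with h2 | h2
    · refine prim ω ((K.mem_primitive hk ω).2 ⟨hω, ?_⟩)
      rw [K.totalDimension.1 _ (by omega)] at hmem
      exact (Submodule.mem_bot ℂ).1 hmem
    · obtain ⟨β, hβ, hβω⟩ := (K.L_pow_bijOn (k := k - 2) (by omega)).surjOn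
        (show (K.L ^ (n - k + 1)) ω ∈ C.grading (2 * n - (k - 2)) by
          rwa [show 2 * (n - k + 1) + k = 2 * n - (k - 2) by omega] at hmem)
      have hLβ := K.L_pow_mem 1 (k - 2) hβ
      rw [show 2 * 1 + (k - 2) = k by omega] at hLβ
      have h1 : ω - (K.L ^ 1) β ∈ K.primitive k := by
        refine (K.mem_primitive hk _).2 ⟨Submodule.sub_mem _ hω hLβ, ?_⟩
        rw [map_sub, L_pow_L_pow, show n - k + 1 + 1 = n - (k - 2) by omega, hβω, sub_self]
      have h3 := Submodule.add_mem _ (prim _ h1)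
        (K.L_pow_mem_range 1 (ih (k - 2) (by omega) (by omega) hβ))
      rwa [sub_add_cancel] at h3

theorem lefschetzSum_surjective (K : HermitianStructure C n) :
    Function.Surjective K.lefschetzSum := by
  classical
  rw [← LinearMap.range_eq_top, eq_top_iff]
  intro ω _
  rw [← DirectSum.sum_support_decompose C.grading ω]
  refine Submodule.sum_mem _ fun k _ => ?_
  have hω : (DirectSum.decompose C.grading ω k : Ω) ∈ C.grading k := SetLike.coe_mem _
  generalize (DirectSum.decompose C.grading ω k : Ω) = η at hω
  rcases le_or_gt k n with hk | hk
  · exact K.grading_le_range hk hω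
  rcases le_or_gt k (2 * n) with hk2 | hk2
  · obtain ⟨β, hβ, rfl⟩ := (K.L_pow_bijOn (k := 2 * n - k) (by omega)).surjOn
      (show η ∈ C.grading (2 * n - (2 * n - k)) by
        rwa [show 2 * n - (2 * n - k) = k by omega])
    exact K.L_pow_mem_range _ (K.grading_le_range (by omega) hβ)
  · rw [K.totalDimension.1 _ hk2, Submodule.mem_bot] at hω
    rw [hω]
    exact Submodule.zero_mem _

/-- The operator equal to `i^{a-b}` on `Ω^{(a,b)}`. -/
def weil (K : HermitianStructure C n) : Module.End ℂ Ω :=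
  (DirectSum.toModule ℂ (ℕ × ℕ) Ω fun p =>
    (Complex.I ^ ((p.1 : ℤ) - p.2)) • (K.bigrading p).subtype) ∘ₗ
      (DirectSum.decomposeLinearEquiv K.bigrading).toLinearMap

theorem weil_apply (K : HermitianStructure C n) {a b : ℕ} {ω : Ω}
    (hω : ω ∈ K.bigrading (a, b)) : K.weil ω = Complex.I ^ ((a : ℤ) - b) • ω := by
  rw [weil, LinearMap.comp_apply, LinearEquiv.coe_coe, DirectSum.decomposeLinearEquiv_apply,
    DirectSum.decompose_of_mem _ hω]
  erw [DirectSum.toModule_lof]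
  rfl

theorem isHodgeMap_unique (K : HermitianStructure C n) {h : ℝ} {T T' : Module.End ℂ Ω}
    (hT : K.IsHodgeMap h T) (hT' : K.IsHodgeMap h T') : T = T' := by
  classical
  ext ω
  obtain ⟨x, rfl⟩ := K.lefschetzSum_surjective ω
  rw [lefschetzSum_apply, map_sum, map_sum]
  refine Finset.sum_congr rfl fun i _ => ?_
  have hin := (mem_lefschetzIndex i.1).1 i.2
  have hα := (x i).2
  rw [← DirectSum.sum_support_decompose K.bigrading (x i : Ω), map_sum, map_sum, map_sum]
  refine Finset.sum_congr rfl fun p _ => ?_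
  by_cases hp : p.1 + p.2 = i.1.1
  · have hmem := K.bigraded_component_mem (by omega) hp hα
    rw [hT p.1 p.2 _ (by omega) _ hmem, hT' p.1 p.2 _ (by omega) _ hmem]
  · rw [K.bigraded_component_eq_zero hp ((K.mem_primitive (by omega) _).1 hα).1]
    simp

/-- By the Lefschetz decomposition, the defining property determines a unique operator. -/
theorem existsUnique_isHodgeMap (K : HermitianStructure C n) (h : ℝ) :
    ∃! T : Module.End ℂ Ω, K.IsHodgeMap h T := by
  let E := LinearEquiv.ofBijective K.lefschetzSum
    ⟨K.lefschetzSum_injective, K.lefschetzSum_surjective⟩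
  let c : ℕ → ℕ → ℂ := fun k j => (-1 : ℂ) ^ (k * (k + 1) / 2) *
    ((quantumFactorial h j / quantumFactorial h (n - j - k) : ℝ) : ℂ)
  let Θ : ((i : lefschetzIndex n) → K.primitive i.1.1) →ₗ[ℂ] Ω :=
    ∑ i : lefschetzIndex n, c i.1.1 i.1.2 •
      ((K.L ^ (n - i.1.2 - i.1.1)) ∘ₗ K.weil ∘ₗ (K.primitive i.1.1).subtype ∘ₗ LinearMap.proj i)
  have hex : K.IsHodgeMap h (Θ ∘ₗ E.symm.toLinearMap) := by
    intro a b j hj ω hω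
    have hj' : (a + b) + j ≤ n := by omega
    have hE : E.symm ((K.L ^ j) ω) =
        Pi.single ⟨(a + b, j), (mem_lefschetzIndex _).2 hj'⟩ ⟨ω, hω.1⟩ := by
      rw [LinearEquiv.symm_apply_eq]
      exact (K.L_pow_primitive_mem_range hj' hω.1).symm
    rw [LinearMap.comp_apply, LinearEquiv.coe_coe, hE]
    simp only [Θ, LinearMap.sum_apply, LinearMap.smul_apply, LinearMap.comp_apply,
      LinearMap.proj_apply, Submodule.subtype_apply]
    rw [Finset.sum_eq_single ⟨(a + b, j), (mem_lefschetzIndex _).2 hj'⟩]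
    · rw [Pi.single_eq_same, K.weil_apply hω.2, map_smul, smul_smul]
      congr 1
      simp only [c]
      ring
    · intro i _ hi
      rw [Pi.single_eq_of_ne hi]; simp
    · intro h; exact absurd (Finset.mem_univ _) h
  exact ⟨_, hex, fun T hT => K.isHodgeMap_unique hT hex⟩

/-- The `h`-Hodge map. -/
def hodge (K : HermitianStructure C n) (h : ℝ) : Module.End ℂ Ω :=
  (K.existsUnique_isHodgeMap h).choose

/-- The associated orientation `vol : Ω^{2n} → A`, the restriction of the `h`-Hodge map to the
forms of top degree, extended by zero to the forms of lower degree. -/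
def vol (K : HermitianStructure C n) (h : ℝ) : Ω →ₗ[ℂ] A :=
  C.zeroPart ∘ₗ K.hodge h ∘ₗ GradedAlgebra.proj C.grading (2 * n)

/-- The metric `g(ω, ν) = vol(ω ∧ *_h(ν*))`. As the Hodge map sends `Ω^l` to `Ω^{2n-l}`
and `vol` is zero below the top degree, this vanishes for `ω ∈ Ω^k`, `ν ∈ Ω^l` with `k ≠ l`. -/
def metric (K : HermitianStructure C n) (h : ℝ) (ω ν : Ω) : A :=
  K.vol h (ω * K.hodge h (C.st ν))

/-- A Kähler structure is an Hermitian structure with `d`-closed Hermitian form. -/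
def IsKahler (K : HermitianStructure C n) : Prop := C.d K.form = 0

end HermitianStructure

end Structures

/-! ### Covariance over a quantum homogeneous space -/

section Covariant

variable {G H : Type*} [Ring G] [StarRing G] [HopfAlgebra ℂ G]
  [Ring H] [StarRing H] [HopfAlgebra ℂ H]

/-- The subspace `M⁺ Ω` of a calculus over a quantum homogeneous space `M`, where
`M⁺ = M ∩ ker ε`. -/
def augSubmodule [HopfStarAlgebra G] [HopfStarAlgebra H] {Q : QuantumHomogeneousSpace G H}
    {Ω : Type*} [Ring Ω] [Algebra ℂ Ω] (C : DifferentialCalculus Q.space Ω) : Submodule ℂ Ω :=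
  Submodule.span ℂ
    {x | ∃ (m : Q.space) (ω : Ω), Coalgebra.counit (R := ℂ) (m : G) = 0 ∧ x = C.ι m * ω}

/-- A covariant differential `*`-calculus over the quantum homogeneous space `M`: the left coaction
of `M` extends to an algebra map `Δ_L : Ω → G ⊗ Ω` with
`Δ_L(m dm') = Δ_L(m) ((id ⊗ d) Δ_L(m'))`; moreover `Ω M⁺ ⊆ M⁺ Ω`, and `Φ(Ω) = Ω / M⁺ Ω` has finite
dimension. The map `Δ_L` is determined by these properties, and the comodule axioms for it
follow. -/
structure CovariantCalculus [HopfStarAlgebra G] [HopfStarAlgebra H]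
    (Q : QuantumHomogeneousSpace G H) (Ω : Type*) [Ring Ω] [Algebra ℂ Ω]
    extends StarCalculus Q.space Ω where
  coaction : Ω →ₐ[ℂ] G ⊗[ℂ] Ω
  coaction_ι : ∀ m, coaction (ι m) = ι.toLinearMap.lTensor G (Q.leftCoaction m)
  coaction_d : ∀ m m' : Q.space,
    coaction (ι m * d (ι m')) = coaction (ι m) * d.lTensor G (coaction (ι m'))
  mul_mem_augSubmodule : ∀ (ω : Ω) (m : Q.space),
    Coalgebra.counit (R := ℂ) (m : G) = 0 → ω * ι m ∈ augSubmodule toDifferentialCalculus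
  finiteDimensional : FiniteDimensional ℂ (Ω ⧸ augSubmodule toDifferentialCalculus)

namespace CovariantCalculus

/-- The space `V = Φ(Ω) = Ω / M⁺ Ω`. -/
abbrev fibre [HopfStarAlgebra G] [HopfStarAlgebra H] {Q : QuantumHomogeneousSpace G H}
    {Ω : Type*} [Ring Ω] [Algebra ℂ Ω] (C : CovariantCalculus Q Ω) : Type _ :=
  Ω ⧸ augSubmodule C.toDifferentialCalculus

end CovariantCalculus

namespace HermitianStructure

/-- Covariance of an Hermitian structure: every `Ω^{(a,b)}` is a left `G`-subcomodule of `Ω`, and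
the Hermitian form is left `G`-coinvariant. (Each `Ω^{(a,b)}` is an `M`-subbimodule by the
grading.) -/
structure IsCovariant [HopfStarAlgebra G] [HopfStarAlgebra H] {Q : QuantumHomogeneousSpace G H}
    {Ω : Type*} [Ring Ω] [Algebra ℂ Ω] {n : ℕ} (C : CovariantCalculus Q Ω)
    (K : HermitianStructure C.toStarCalculus n) : Prop where
  coaction_mem : ∀ p, ∀ ω ∈ K.bigrading p,
    C.coaction ω ∈ LinearMap.range ((K.bigrading p).subtype.lTensor G)
  coaction_form : C.coaction K.form = 1 ⊗ₜ[ℂ] K.form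

/-- Positive definiteness: `[ω] ⊗ [ν] ↦ [g(ω, ν)]` is a well-defined inner product on
`V = Ω / M⁺ Ω`. Here `Φ(M) = M / M⁺` is identified with `ℂ` through the counit, and the inner
product is linear in `[ω]` (the second argument of `inner`) and conjugate-linear in `[ν]`. -/
def IsPositiveDefinite [HopfStarAlgebra G] [HopfStarAlgebra H] {Q : QuantumHomogeneousSpace G H}
    {Ω : Type*} [Ring Ω] [Algebra ℂ Ω] {n : ℕ} (C : CovariantCalculus Q Ω)
    (K : HermitianStructure C.toStarCalculus n) (h : ℝ) : Prop :=
  ∃ c : InnerProductSpace.Core ℂ C.fibre, ∀ ω ν : Ω,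
    c.inner (Submodule.Quotient.mk ν) (Submodule.Quotient.mk ω) =
      Coalgebra.counit (R := ℂ) (K.metric h ω ν : G)

/-- The associated integral, `∫ ω = haar (vol ω)`. -/
def integral [CompactQuantumGroupAlgebra G] [HopfStarAlgebra H] {Q : QuantumHomogeneousSpace G H}
    {Ω : Type*} [Ring Ω] [Algebra ℂ Ω] {n : ℕ} (C : CovariantCalculus Q Ω)
    (K : HermitianStructure C.toStarCalculus n) (h : ℝ) : Ω →ₗ[ℂ] ℂ :=
  haar G ∘ₗ Q.incl ∘ₗ K.vol h

/-- The associated integral is closed: `∫ dω = 0` for all forms `ω` of degree `2n - 1`. -/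
def HasClosedIntegral [CompactQuantumGroupAlgebra G] [HopfStarAlgebra H]
    {Q : QuantumHomogeneousSpace G H} {Ω : Type*} [Ring Ω] [Algebra ℂ Ω] {n : ℕ}
    (C : CovariantCalculus Q Ω) (K : HermitianStructure C.toStarCalculus n) (h : ℝ) : Prop :=
  ∀ k, k + 1 = 2 * n → ∀ ω ∈ C.grading k, K.integral C h (C.d ω) = 0

end HermitianStructure

end Covariant

end NCKahler

end

namespace NCKahler

/-! Multiplication by `κ^k` embeds the closed functions into the cohomology of degree `2k`. Since
`κ` is closed and of even degree, `L^k` commutes with `d`, so `κ^k f` is closed whenever `f` is.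
There are no nonzero exact `0`-forms, so `H^0` is the space of closed functions, and it remains to
see that `κ^k f = dω` forces `f = 0`.

The reason is a pairing with `f*`. The involution commutes with `d`, so `f*` is closed too, and
`d(κ^(n-k) ω f*) = κ^(n-k) (dω) f* = κ^n f f*`. Thus a top form that sees only `f f*` is exact, and
closedness of the integral makes its integral zero. On the other hand the Hodge formula in bidegree
`(0,0)` gives `vol(κ^n f f*) = [n]_h! f f*`, so the integral equals `[n]_h! haar(f f*)`. The factor
`[n]_h!` is positive because `h > 0`, and the Haar functional is strictly positive on `f f*` unless
`f = 0`.

The argument is carried by `d_L_pow`, `vol_form_pow_mul_ι` and `eq_zero_of_L_pow_exact`;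
`rank_cohomology_zero_le` turns it into an inequality of cardinals. The bound `dim H^0 ≥ 1` comes
from the closed function `1`. -/

theorem quantumInt_pos {h : ℝ} (hh : 0 < h) {m : ℕ} (hm : 0 < m) : 0 < quantumInt h m :=
  Finset.sum_pos (fun _ _ => zpow_pos hh _) (Finset.nonempty_range_iff.2 hm.ne')

/-- Used to cancel the normalising constant `[n]_h!` from the vanishing integral. -/
theorem quantumFactorial_pos {h : ℝ} (hh : 0 < h) (m : ℕ) : 0 < quantumFactorial h m :=
  Finset.prod_pos fun i _ => quantumInt_pos hh i.succ_pos

/-! ### Closed forms and cohomology of a differential calculus. -/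

namespace DifferentialCalculus

variable {A Ω : Type*} [Ring A] [Algebra ℂ A] [Ring Ω] [Algebra ℂ Ω]
  (C : DifferentialCalculus A Ω)

theorem d_one : C.d 1 = 0 := by
  -- The Leibniz rule for `1 * 1` in degree `0` reads `d 1 = d 1 + d 1`.
  have h := C.leibniz 0 1 SetLike.GradedOne.one_mem 1
  simpa using h

theorem ι_mem (a : A) : C.ι a ∈ C.grading 0 := by
  rw [← C.range_ι]
  exact ⟨a, rfl⟩

theorem zeroPart_ι (a : A) : C.zeroPart (C.ι a) = a := by
  rw [zeroPart, LinearMap.comp_apply, LinearEquiv.coe_coe, LinearEquiv.symm_apply_eq]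
  refine Subtype.ext ?_
  rw [LinearMap.codRestrict_apply, GradedAlgebra.proj_apply,
    DirectSum.decompose_of_mem_same _ (C.ι_mem a)]
  rfl

/-- The right Leibniz rule against a closed form. -/
theorem d_mul_of_closed_right {k : ℕ} {α : Ω} (hα : α ∈ C.grading k) {β : Ω} (hβ : C.d β = 0) :
    C.d (α * β) = C.d α * β := by
  rw [C.leibniz k α hα, hβ, mul_zero, smul_zero, add_zero]

theorem d_pow_eq_zero {k : ℕ} {α : Ω} (hα : α ∈ C.grading k) (hd : C.d α = 0) (r : ℕ) :
    C.d (α ^ r) = 0 := by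
  induction r with
  | zero => rw [pow_zero, C.d_one]
  | succ r ih => rw [pow_succ, C.d_mul_of_closed_right (SetLike.pow_mem_graded r hα) hd, ih,
      zero_mul]

/-- The class of `1` is nonzero, because only `0` is exact in degree zero. -/
theorem rank_cohomology_zero_pos [Nontrivial Ω] : 1 ≤ Module.rank ℂ (C.Cohomology 0) := by
  rw [Cardinal.one_le_iff_pos, rank_pos_iff_exists_ne_zero]
  refine ⟨Submodule.Quotient.mk ⟨1, SetLike.GradedOne.one_mem, C.d_one⟩, fun h => ?_⟩
  rw [Submodule.Quotient.mk_eq_zero] at h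
  exact one_ne_zero ((Submodule.mem_bot ℂ).1 h)

/-- An operator that takes closed `0`-forms to closed `k`-forms, and nonzero ones to forms that are
not exact, shows that `dim H^0 ≤ dim H^k`. -/
theorem rank_cohomology_zero_le (T : Module.End ℂ Ω) {k : ℕ}
    (hT : ∀ f ∈ C.closedForms 0, T f ∈ C.closedForms k)
    (hex : ∀ f ∈ C.closedForms 0, T f ∈ C.exactForms k → f = 0) :
    Module.rank ℂ (C.Cohomology 0) ≤ Module.rank ℂ (C.Cohomology k) := by
  -- In degree zero nothing is divided out, so a map on `H^0` can be defined on closed forms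
  -- directly, with no descent to a quotient to check.
  have hbot : (C.exactForms 0).submoduleOf (C.closedForms 0) = ⊥ := by
    rw [eq_bot_iff]
    intro x hx
    exact (Submodule.mem_bot ℂ).2 (Subtype.ext ((Submodule.mem_bot ℂ).1 hx))
  let E := Submodule.quotEquivOfEqBot _ hbot
  let F : C.closedForms 0 →ₗ[ℂ] C.Cohomology k :=
    Submodule.mkQ _ ∘ₗ T.restrict hT
  have hF : Function.Injective F := by
    rw [← LinearMap.ker_eq_bot, LinearMap.ker_eq_bot']
    intro f hf
    rw [LinearMap.comp_apply, Submodule.mkQ_apply, Submodule.Quotient.mk_eq_zero] at hf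
    exact Subtype.ext (hex f f.2 hf)
  exact E.rank_eq.trans_le (LinearMap.rank_le_of_injective F hF)

end DifferentialCalculus

/-! ### Powers of the Kähler form, the volume and the differential. -/

namespace HermitianStructure

section

variable {A Ω : Type*} [Ring A] [StarRing A] [Algebra ℂ A] [Ring Ω] [Algebra ℂ Ω]
  {C : StarCalculus A Ω} {n : ℕ}

/-- Both conditions hold for degree reasons: `L^(n+1)` sends functions to degree `2n + 2`, above the
total dimension, and `(0,0)` is the only bidegree of total degree zero. This makes the Hodge formula
available for `κ^n a`. -/
theorem ι_mem_bigradedPrimitive (K : HermitianStructure C n) (a : A) :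
    C.ι a ∈ K.bigradedPrimitive 0 0 := by
  have h0 : C.ι a ∈ C.grading 0 := C.ι_mem a
  refine Submodule.mem_inf.2 ⟨(K.mem_primitive n.zero_le _).2 ⟨h0, ?_⟩, ?_⟩
  · have h := K.L_pow_mem (n - 0 + 1) 0 h0
    rw [K.totalDimension.1 _ (by omega)] at h
    exact (Submodule.mem_bot ℂ).1 h
  · rw [K.grading_eq] at h0
    refine (iSup_le ?_ : (⨆ p : {p : ℕ × ℕ // p.1 + p.2 = 0}, K.bigrading p) ≤ _) h0
    rintro ⟨⟨a, b⟩, hab⟩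
    obtain ⟨rfl, rfl⟩ : a = 0 ∧ b = 0 := by simpa using hab
    exact le_rfl

/-- `vol(κⁿ a) = [n]_h! a`. -/
theorem vol_form_pow_mul_ι (K : HermitianStructure C n) (h : ℝ) (a : A) :
    K.vol h (K.form ^ n * C.ι a) = ((quantumFactorial h n : ℝ) : ℂ) • a := by
  have hmem := K.L_pow_mem n 0 (C.ι_mem a)
  rw [add_zero] at hmem
  -- The defining formula at `a = b = 0`, `j = n`: the sign, the power of `i` and `[0]_h!` are all
  -- `1`, and the remaining power of `L` is `L^0`.
  have hodge := (K.existsUnique_isHodgeMap h).choose_spec.1 0 0 n (by omega) _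
    (K.ι_mem_bigradedPrimitive a)
  rw [← K.L_pow_apply, vol, LinearMap.comp_apply, LinearMap.comp_apply, GradedAlgebra.proj_apply,
    DirectSum.decompose_of_mem_same _ hmem]
  change K.hodge h _ = _ at hodge
  rw [hodge]
  simp [quantumFactorial, C.zeroPart_ι]

/-- The Leibniz rule leaves only the term in which `d` passes `κ^r`, and it does so without a sign
because `κ^r` has even degree `2r`. -/
theorem d_L_pow (K : HermitianStructure C n) (hK : K.IsKahler) (r : ℕ) (ω : Ω) :
    C.d ((K.L ^ r) ω) = (K.L ^ r) (C.d ω) := by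
  have hmem := SetLike.pow_mem_graded r K.almostSymplectic.mem
  rw [K.L_pow_apply, K.L_pow_apply, C.leibniz _ _ hmem,
    C.d_pow_eq_zero K.almostSymplectic.mem hK, zero_mul, zero_add, smul_eq_mul, mul_comm r,
    pow_mul, neg_one_sq, one_pow, one_smul]

end

/-! ### Positivity of the Haar functional against exactness. -/

variable {G H Ω : Type*} [Ring G] [StarRing G] [HopfAlgebra ℂ G] [CompactQuantumGroupAlgebra G]
  [Ring H] [StarRing H] [HopfAlgebra ℂ H] [HopfStarAlgebra H] [Ring Ω] [Algebra ℂ Ω]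
  {Q : QuantumHomogeneousSpace G H} {C : CovariantCalculus Q Ω} {n : ℕ}

/-- If the integral is closed, then a closed function `f` with `κᵏ f` exact vanishes: otherwise
`0 = ∫ κⁿ f f* = [n]_h! haar(f f*) > 0`. -/
theorem eq_zero_of_L_pow_exact (K : HermitianStructure C.toStarCalculus n) (hK : K.IsKahler)
    {h : ℝ} (hh : 0 < h) (hint : K.HasClosedIntegral C h) {k : ℕ} (hk : k ≤ n) {f : Ω}
    (hf : f ∈ C.closedForms 0) (hex : (K.L ^ k) f ∈ C.exactForms (2 * k)) : f = 0 := by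
  obtain ⟨hf0, hdf⟩ := hf
  rw [SetLike.mem_coe, LinearMap.mem_ker] at hdf
  rw [SetLike.mem_coe, ← C.range_ι] at hf0
  obtain ⟨a, rfl⟩ := hf0
  rw [AlgHom.toLinearMap_apply] at hdf hex ⊢
  -- For `k = 0` the form `f` itself is exact of degree zero, hence zero. The primitive `ω` below
  -- exists only in positive degree, where it has degree `2k + 1` for the shifted `k`.
  cases k with
  | zero => exact (Submodule.mem_bot ℂ).1 hex
  | succ k =>
    obtain ⟨ω, hω, hdω⟩ := hex
    have hstar : C.d (C.ι (star a)) = 0 := by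
      rw [← C.st_ι, ← C.st_d, hdf, map_zero]
    have hωa := SetLike.mul_mem_graded hω (C.ι_mem (star a))
    have hmem := K.L_pow_mem (n - (k + 1)) _ hωa
    -- Multiplying `dω = κ^(k+1) a` by the closed function `a*` and by the missing power of `κ`
    -- raises it to a top form while keeping it exact.
    have hd : C.d ((K.L ^ (n - (k + 1))) (ω * C.ι (star a))) =
        K.form ^ n * C.ι (a * star a) := by
      rw [K.d_L_pow hK, C.d_mul_of_closed_right hω hstar, hdω, K.L_pow_apply, K.L_pow_apply,
        map_mul, mul_assoc, ← mul_assoc, ← pow_add, Nat.sub_add_cancel hk]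
    -- The degree of this primitive is `2n - 1`, as closedness of the integral requires.
    have h0 := hint (2 * (n - (k + 1)) + (2 * k + 1 + 0)) (by omega) _ hmem
    rw [hd, integral, LinearMap.comp_apply, LinearMap.comp_apply, K.vol_form_pow_mul_ι, map_smul,
      map_smul, smul_eq_mul, mul_eq_zero] at h0
    have h1 : haar G ((a : G) * star (a : G)) = 0 :=
      h0.resolve_left (Complex.ofReal_ne_zero.2 (quantumFactorial_pos hh n).ne')
    have ha : a = 0 := by
      by_contra hne
      exact (CompactQuantumGroupAlgebra.haar_pos (a : G)
        fun h => hne (Subtype.ext h)).ne' h1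
    rw [ha, map_zero]

end HermitianStructure

end NCKahler

/-! ### The inequalities for the even cohomology groups. -/

open NCKahler in
theorem corollary7p12 {G H Ω : Type*}
    [Ring G] [StarRing G] [HopfAlgebra ℂ G] [CompactQuantumGroupAlgebra G]
    [Ring H] [StarRing H] [HopfAlgebra ℂ H] [HopfStarAlgebra H] [CosemisimpleHopfAlgebra H]
    [Ring Ω] [Algebra ℂ Ω]
    (Q : QuantumHomogeneousSpace G H) (C : CovariantCalculus Q Ω)
    (n : ℕ) (K : HermitianStructure C.toStarCalculus n)
    (hcov : K.IsCovariant C) (hkahler : K.IsKahler)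
    (h : ℝ) (hh : 0 < h)
    (hpos : K.IsPositiveDefinite C h) (hint : K.HasClosedIntegral C h)
    (k : ℕ) (hk : k ≤ n) :
    Module.rank ℂ (C.Cohomology 0) ≤ Module.rank ℂ (C.Cohomology (2 * k)) ∧
      1 ≤ Module.rank ℂ (C.Cohomology 0) := by
  refine ⟨C.rank_cohomology_zero_le (K.L ^ k) (fun f hf => ⟨?_, ?_⟩)
    fun f hf => K.eq_zero_of_L_pow_exact hkahler hh hint hk hf, ?_⟩
  · exact K.L_pow_mem k 0 hf.1
  · rw [SetLike.mem_coe, LinearMap.mem_ker, K.d_L_pow hkahler, LinearMap.mem_ker.1 hf.2, map_zero]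
  · obtain ⟨x, -, hx⟩ := Submodule.exists_mem_ne_zero_of_ne_bot K.totalDimension.2
    have : Nontrivial Ω := ⟨x, 0, hx⟩
    exact C.rank_cohomology_zero_pos
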